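/- Let $K$ be a field and $n\ge 0$, and write $\mathbf x=(x_1,\dots,x_n)$, $\mathbf y=(y_1,\dots,y_n)$. For a totally ordered abelian group $\Gamma$ and a field $L$, let $L_w[\Gamma]$ be the field of Malcev--Neumann series on $\Gamma$ over $L$, i.e. of the formal series $\sum_{\gamma\in\Gamma}a_\gamma t^\gamma$ ($a_\gamma \in L$) with well-ordered support. Consider the following fields. - $L\langle\langle x_1,\dots,x_n\rangle\rangle$, the field of iterated Laurent series, is $L_w[\mathbb Z^n]$, where $\mathbb Z^n$ (the group of exponents of monomials) has the reverse lexicographic order (the last coordinate is compared first). - $K^\rho\langle\langle x_1,\dots,x_n\rangle\rangle$ is $K_w[\mathbb Z^n]$, where $\mathbb Z^n$ has the order induced from the reverse lexicographic order of $\mathbb Z^{n+1}$ by the injective homomorphism $\rho$ given by $x_i\mapsto x_it$, that is, $\rho(k_1,\dots,k_n)=(k_1,\dots,k_n,k_1+\cdots+k_n)$. - $K^\rho\langle\langle\mathbf x\rangle\rangle\langle\langle\mathbf y\rangle\rangle$ is the field of iterated Laurent series in $\mathbf y$ over $L=K^\rho\langle\langle\mathbf x\rangle\rangle$. Both $K\langle\langle\mathbf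 x\rangle\rangle$ and $K^\rho\langle\langle\mathbf x\rangle\rangle$ contain $K[[\mathbf x]]$. In each field $\operatorname{Res}_{\mathbf x}$ denotes the coefficient of $x_1^{-1}\cdots x_n^{-1}$; on $K^\rho\langle\langle\mathbf x\rangle\rangle\langle\langle\mathbf y\rangle\rangle$ it is applied to the coefficient of each monomial in $\mathbf y$ and has values in $K\langle\langle\mathbf y\rangle\rangle$. Let $F_1,\dots,F_n\in K[[\mathbf x]]$ with $F_i=x_i+(\text{terms of total degree}\ge 2)$, and let $\mathbf G=(G_1,\dots,G_n)$ be the compositional inverse of $\mathbf F=(F_1,\dots,F_n)$: the $G_i$ are power series without constant term such that $F_i(G_1,\dots,G_n)=x_i$ and $G_i(F_1,\dots,F_n)=x_i$ for all $i$. Let $J(\mathbf F)=\det(\partial F_i/\partial x_j)_{1\le i,j\le n}$. Then for every $\Phi\in K[[y_1,\dots,y_n]]$: 1. With the inverses and the residue taken in $K^\rho\langle\langle\mathbf x\rangle\rangle\langle\langle\mathbf y\rangle\rangle$, $$\Phi(\mathbf G(\mathbf y))=\operatorname{Res}_{\mathbf x}\frac1{F_1-y_1}\cdots\frac1{F_n-y_n}\,J(\mathbf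 F)\,\Phi(\mathbf x),$$ as an identity of power series in $\mathbf y$ (inside $K\langle\langle\mathbf y\rangle\rangle$). 2. For all integers $k_1,\dots,k_n\ge 0$, with the residue taken in $K^\rho\langle\langle\mathbf x\rangle\rangle$, $$[y_1^{k_1}\cdots y_n^{k_n}]\,\Phi(\mathbf G(\mathbf y))=\operatorname{Res}_{\mathbf x}F_1^{-1-k_1}\cdots F_n^{-1-k_n}\,\Phi(\mathbf x)\,J(\mathbf F).$$ 3. (Good's formula.) If $x_i$ divides $F_i$ for every $i$, then for all $k_1,\dots,k_n\ge0$ the formula in 2 also holds with the residue taken in $K\langle\langle x_1,\dots,x_n\rangle\rangle$. For $\Phi=y_i$ this is Good's formula for $[y_1^{k_1}\cdots y_n^{k_n}]\,G_i(\mathbf y)$. -/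

import Mathlib

/-- `ℤⁿ`: exponents of monomials in `n` variables, ordered by the reverse lexicographic order
below. The Malcev-Neumann field `HahnSeries (RevLexExp n) L` over it is the field `L⟪x₁,…,xₙ⟫`
of iterated Laurent series. -/
@[ext]
structure RevLexExp (n : ℕ) : Type where
  /-- the vector of exponents -/
  exp : Fin n → ℤ

namespace RevLexExp

/-- The exponent as a plain vector. -/
def equiv (n : ℕ) : RevLexExp n ≃ (Fin n → ℤ) := ⟨exp, mk, fun _ => rfl, fun _ => rfl⟩

instance (n : ℕ) : AddCommGroup (RevLexExp n) := (equiv n).addCommGroup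

@[simp] theorem exp_add {n : ℕ} (a b : RevLexExp n) : (a + b).exp = a.exp + b.exp := rfl

/-- The reverse lexicographic order: the last coordinate is compared first. -/
noncomputable instance (n : ℕ) : LinearOrder (RevLexExp n) :=
  LinearOrder.lift' (fun a => toColex a.exp) fun _ _ h => RevLexExp.ext (toColex.injective h)

theorem le_def {n : ℕ} {a b : RevLexExp n} : a ≤ b ↔ toColex a.exp ≤ toColex b.exp := Iff.rfl

instance (n : ℕ) : IsOrderedAddMonoid (RevLexExp n) where
  add_le_add_left a b hab c := by
    rw [le_def] at hab ⊢
    rcases hab with h | ⟨i, hi, hlt⟩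
    · rw [exp_add, exp_add, toColex.injective h]
    · exact Or.inr ⟨i, fun j hj => congrArg (· + c.exp j) (hi j hj), Int.add_lt_add_right hlt _⟩

/-- The exponent of a monomial of a power series. -/
def ofNat {n : ℕ} (d : Fin n →₀ ℕ) : RevLexExp n := ⟨fun i => (d i : ℤ)⟩

theorem ofNat_monotone (n : ℕ) : Monotone (ofNat (n := n)) := fun _ _ h =>
  le_def.mpr (Pi.toColex_monotone fun i => Int.ofNat_le.mpr (h i))

end RevLexExp

/-- `ℤⁿ`: exponents of monomials in `n` variables, ordered through the injective homomorphism
`RhoExp.rho` below. The Malcev-Neumann field `HahnSeries (RhoExp n) K` over it is the field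
`K^ρ⟪x₁,…,xₙ⟫`. -/
@[ext]
structure RhoExp (n : ℕ) : Type where
  /-- the vector of exponents -/
  exp : Fin n → ℤ

namespace RhoExp

/-- The exponent as a plain vector. -/
def equiv (n : ℕ) : RhoExp n ≃ (Fin n → ℤ) := ⟨exp, mk, fun _ => rfl, fun _ => rfl⟩

instance (n : ℕ) : AddCommGroup (RhoExp n) := (equiv n).addCommGroup

@[simp] theorem exp_add {n : ℕ} (a b : RhoExp n) : (a + b).exp = a.exp + b.exp := rfl

/-- The injective homomorphism `ρ : xᵢ ↦ xᵢ t` on exponents: the monomial `x^k` goes to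
`x^k t^(k₁ + ⋯ + kₙ)`, a monomial in the variables `x₁, …, xₙ, t`. -/
def rho {n : ℕ} (k : RhoExp n) : RevLexExp (n + 1) := ⟨Fin.snoc k.exp (∑ i, k.exp i)⟩

theorem rho_injective (n : ℕ) : Function.Injective (rho (n := n)) := by
  intro a b h
  ext i
  simpa [rho] using congrFun (congrArg RevLexExp.exp h) i.castSucc

theorem rho_add {n : ℕ} (a b : RhoExp n) : rho (a + b) = rho a + rho b := by
  ext i
  refine Fin.lastCases ?_ (fun i => ?_) i <;> simp [rho, Finset.sum_add_distrib]

/-- The order on `ℤⁿ` induced by `ρ`. -/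
noncomputable instance (n : ℕ) : LinearOrder (RhoExp n) :=
  LinearOrder.lift' rho (rho_injective n)

theorem le_def {n : ℕ} {a b : RhoExp n} : a ≤ b ↔ rho a ≤ rho b := Iff.rfl

instance (n : ℕ) : IsOrderedAddMonoid (RhoExp n) where
  add_le_add_left a b h c := by
    rw [le_def] at h ⊢
    rw [rho_add, rho_add]
    exact add_le_add_left h (rho c)

/-- The exponent of a monomial of a power series. -/
def ofNat {n : ℕ} (d : Fin n →₀ ℕ) : RhoExp n := ⟨fun i => (d i : ℤ)⟩

theorem ofNat_monotone (n : ℕ) : Monotone (ofNat (n := n)) := by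
  intro a b h
  rw [le_def, RevLexExp.le_def]
  refine Pi.toColex_monotone fun i => ?_
  refine Fin.lastCases ?_ (fun i => ?_) i
  · simpa [rho, ofNat] using Finset.sum_le_sum fun i _ => Int.ofNat_le.mpr (h i)
  · simpa [rho, ofNat] using h i

end RhoExp

/-- A formal power series `∑ a_d x^d`, read as the Malcev-Neumann series `∑ a_d t^(e d)`. -/
noncomputable def powerSeriesToHahn {K Γ : Type*} [Field K] [PartialOrder Γ] {n : ℕ}
    (e : (Fin n →₀ ℕ) → Γ) (he : Monotone e) (φ : MvPowerSeries (Fin n) K) :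
    HahnSeries Γ K where
  coeff := Function.extend e (fun d => MvPowerSeries.coeff d φ) 0
  isPWO_support' := by
    refine ((Set.isPWO_of_wellQuasiOrderedLE Set.univ).image_of_monotone he).mono ?_
    intro g hg
    by_contra hne
    exact hg (Function.extend_apply' _ _ _ fun ⟨d, hd⟩ => hne ⟨d, Set.mem_univ d, hd⟩)

/-- The inclusion of `K[[x₁,…,xₙ]]` in `K^ρ⟪x₁,…,xₙ⟫`. -/
noncomputable def toRho {K : Type*} [Field K] {n : ℕ} (φ : MvPowerSeries (Fin n) K) :
    HahnSeries (RhoExp n) K :=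
  powerSeriesToHahn RhoExp.ofNat (RhoExp.ofNat_monotone n) φ

/-- The inclusion of `K[[x₁,…,xₙ]]` in `K⟪x₁,…,xₙ⟫`. -/
noncomputable def toRevLex {K : Type*} [Field K] {n : ℕ} (φ : MvPowerSeries (Fin n) K) :
    HahnSeries (RevLexExp n) K :=
  powerSeriesToHahn RevLexExp.ofNat (RevLexExp.ofNat_monotone n) φ

/-- `Res_x` on `K^ρ⟪x₁,…,xₙ⟫`: the coefficient of `x₁⁻¹⋯xₙ⁻¹`. -/
noncomputable def resRho {K : Type*} [Field K] {n : ℕ} (η : HahnSeries (RhoExp n) K) : K :=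
  η.coeff ⟨fun _ => -1⟩

/-- `Res_x` on `K⟪x₁,…,xₙ⟫`: the coefficient of `x₁⁻¹⋯xₙ⁻¹`. -/
noncomputable def resRevLex {K : Type*} [Field K] {n : ℕ} (η : HahnSeries (RevLexExp n) K) : K :=
  η.coeff ⟨fun _ => -1⟩

/-- `Res_x : K^ρ⟪x₁,…,xₙ⟫⟪y₁,…,yₙ⟫ → K⟪y₁,…,yₙ⟫`, the coefficient of `x₁⁻¹⋯xₙ⁻¹`, which is taken
in the coefficient of every monomial in the `y`'s. -/
noncomputable def resX {K : Type*} [Field K] {n : ℕ}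
    (η : HahnSeries (RevLexExp n) (HahnSeries (RhoExp n) K)) : HahnSeries (RevLexExp n) K :=
  η.map (⟨resRho, rfl⟩ : ZeroHom (HahnSeries (RhoExp n) K) K)

/-- The inclusion of `K[[x₁,…,xₙ]]` in the working field `K^ρ⟪x₁,…,xₙ⟫⟪y₁,…,yₙ⟫`. -/
noncomputable def inX {K : Type*} [Field K] {n : ℕ} (φ : MvPowerSeries (Fin n) K) :
    HahnSeries (RevLexExp n) (HahnSeries (RhoExp n) K) :=
  HahnSeries.C (toRho φ)

/-- The variable `yᵢ` of the working field `K^ρ⟪x₁,…,xₙ⟫⟪y₁,…,yₙ⟫`. -/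
noncomputable def yVar (K : Type*) [Field K] {n : ℕ} (i : Fin n) :
    HahnSeries (RevLexExp n) (HahnSeries (RhoExp n) K) :=
  HahnSeries.single ⟨Pi.single i 1⟩ 1

/-- The Jacobian determinant `J(F) = det (∂Fᵢ/∂xⱼ)`. -/
noncomputable def jacobianDet {K : Type*} [Field K] {n : ℕ}
    (F : Fin n → MvPowerSeries (Fin n) K) : MvPowerSeries (Fin n) K :=
  Matrix.det (Matrix.of fun i j => MvPowerSeries.pderiv K j (F i))

/-- `G` is the compositional inverse of `F`: both can be substituted in power series (they have
no constant terms), `Fᵢ(G₁,…,Gₙ) = xᵢ` and `Gᵢ(F₁,…,Fₙ) = xᵢ` for all `i`. -/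
def IsCompInverse {K : Type*} [Field K] {n : ℕ} (F G : Fin n → MvPowerSeries (Fin n) K) : Prop :=
  (∀ i, MvPowerSeries.constantCoeff (F i) = 0) ∧
  (∀ i, MvPowerSeries.constantCoeff (G i) = 0) ∧
  (∀ i, MvPowerSeries.subst G (F i) = MvPowerSeries.X i) ∧
  (∀ i, MvPowerSeries.subst F (G i) = MvPowerSeries.X i)

/-! Put `Ψ = Φ ∘ G`, so that `Φ = Ψ(F)`. Everything reduces to the residue of `F^(d-1-k) J(F)` being
`1` for `d = k` and `0` otherwise: expanding `Ψ(F)` in monomials `F^d` then isolates the coefficient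
of `y^k` in `Ψ`. To compute these residues, use the Euler derivations `D_j = x_j ∂/∂x_j`. In terms
of the matrix `M` of logarithmic derivatives `F_i⁻¹ D_j F_i`, the residue is the constant term of
`F^r det M` with `r = d - k`. The rows of `M` are closed, and the row of the `D_j (F^r)` is `F^r ∑
r_i M_i`. Putting it in place of row `i` of `M` yields determinant `r_i F^r det M`, which is also a
divergence `∑ ± D_j(…)` and so has constant term `0` (`zsmul_map_prod_zpow_mul_det_logDeriv`). In
characteristic zero this settles `r ≠ 0`; if `r = 0`, then `M` is the identity plus terms of
positive degree. Any other characteristic is reached by specializing from a polynomial ring over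
`ℤ`. In the order given by `ρ` the total degree is monotone, so `F_i = x_i (1 + higher degree)` has
an inverse of degree at least `-1`. Hence only finitely many terms of `Ψ` affect a given residue
(`resRho_prod_zpow_mul_subst`). Part 1 is the generating function of part 2, by the geometric
series. In part 3, `F_i` is `x_i` times an invertible power series, and its negative powers are the
same series in both fields. -/

/-! ### Logarithmic derivatives, and determinants that are divergences -/

namespace Derivation

variable {S A : Type*} [CommRing S] [CommRing A] [Algebra S A]

/-- The logarithmic derivative `u ↦ u⁻¹ D(u)` of a derivation, on the group of units. -/
def logDeriv (D : Derivation S A A) : Aˣ →* Multiplicative A where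
  toFun u := Multiplicative.ofAdd (↑u⁻¹ * D u)
  map_one' := by simp
  map_mul' u v := by
    rw [← ofAdd_add]
    congr 1
    simp only [mul_inv, Units.val_mul, leibniz, smul_eq_mul]
    linear_combination (↑v⁻¹ * D v) * u.inv_mul + (↑u⁻¹ * D u) * v.inv_mul

theorem apply_unit (D : Derivation S A A) (u : Aˣ) :
    D u = u * (D.logDeriv u).toAdd := by
  simp [logDeriv]

theorem logDeriv_prod_zpow {ι : Type*} [Fintype ι] (D : Derivation S A A) (u : ι → Aˣ)
    (r : ι → ℤ) :
    (D.logDeriv (∏ i, u i ^ r i)).toAdd = ∑ i, r i • (D.logDeriv (u i)).toAdd := by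
  simp [map_prod, map_zpow]

/-- The form `du/u` is closed: both sides equal `u⁻¹ D(E u) - u⁻² D(u) E(u)`, which is symmetric
once `D` and `E` commute. -/
theorem apply_logDeriv_comm {D E : Derivation S A A} (h : ∀ a, D (E a) = E (D a)) (u : Aˣ) :
    D (E.logDeriv u).toAdd = E (D.logDeriv u).toAdd := by
  have key (D : Derivation S A A) : D ((u⁻¹ : Aˣ) : A) = -(↑u⁻¹ * ↑u⁻¹ * D u) := by
    have h1 := D.leibniz (u : A) ((u⁻¹ : Aˣ) : A)
    rw [u.mul_inv, map_one_eq_zero] at h1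
    simp only [smul_eq_mul] at h1
    linear_combination (-(u⁻¹ : Aˣ) : A) * h1 - (D ((u⁻¹ : Aˣ) : A)) * u.inv_mul
  simp only [logDeriv, MonoidHom.coe_mk, OneHom.coe_mk, toAdd_ofAdd, leibniz, smul_eq_mul, key, h]
  ring

theorem leibniz_finset_prod {ι : Type*} [DecidableEq ι] (D : Derivation S A A) (s : Finset ι)
    (f : ι → A) : D (∏ i ∈ s, f i) = ∑ l ∈ s, (∏ i ∈ s.erase l, f i) * D (f l) := by
  induction s using Finset.induction_on with
  | empty => simp
  | insert a s ha ih =>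
    rw [Finset.prod_insert ha, leibniz, ih, Finset.sum_insert ha, Finset.erase_insert ha,
      smul_eq_mul, smul_eq_mul, Finset.mul_sum, add_comm]
    congr 1
    refine Finset.sum_congr rfl fun l hl => ?_
    rw [Finset.erase_insert_of_ne (by rintro rfl; exact ha hl), Finset.prod_insert, mul_assoc]
    exact fun h => ha (Finset.mem_of_mem_erase h)

variable {ι : Type*} [Fintype ι] [DecidableEq ι]

/-- A determinant whose rows are closed, one of them being exact, is a divergence. -/
theorem det_updateRow_eq_sum (D : ι → Derivation S A A) (M : Matrix ι ι A)
    (hM : ∀ i j k, D j (M i k) = D k (M i j)) (i₀ : ι) (g : A) :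
    (M.updateRow i₀ fun j => D j g).det = ∑ σ : Equiv.Perm ι, Equiv.Perm.sign σ •
      D (σ i₀) (g * ∏ i ∈ Finset.univ.erase i₀, M i (σ i)) := by
  -- The cofactors along row `i₀` are divergence free. After the product rule, composing `σ` with
  -- the transposition of `i₀` and `l` flips the sign and, by closedness of row `l`, preserves the
  -- rest of the term.
  have h0 : ∑ σ : Equiv.Perm ι, Equiv.Perm.sign σ •
      D (σ i₀) (∏ i ∈ Finset.univ.erase i₀, M i (σ i)) = 0 := by
    simp only [leibniz_finset_prod, Finset.smul_sum]
    rw [Finset.sum_comm]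
    refine Finset.sum_eq_zero fun l hl => ?_
    have hl : i₀ ≠ l := (Finset.ne_of_mem_erase hl).symm
    refine Finset.sum_involution (fun σ _ => σ * Equiv.swap i₀ l) ?_ ?_
      (fun _ _ => Finset.mem_univ _) ?_
    · intro σ _
      have : ∏ i ∈ (Finset.univ.erase i₀).erase l, M i ((σ * Equiv.swap i₀ l) i) =
          ∏ i ∈ (Finset.univ.erase i₀).erase l, M i (σ i) := by
        refine Finset.prod_congr rfl fun i hi => ?_
        simp only [Finset.mem_erase, Finset.mem_univ, and_true] at hi
        rw [Equiv.Perm.mul_apply, Equiv.swap_apply_of_ne_of_ne hi.2 hi.1]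
      rw [this, Equiv.Perm.sign_mul, Equiv.Perm.sign_swap hl, Equiv.Perm.mul_apply,
        Equiv.Perm.mul_apply, Equiv.swap_apply_left, Equiv.swap_apply_right, hM l (σ l) (σ i₀)]
      simp
    · intro σ _ _ h
      have h := Equiv.congr_fun h l
      rw [Equiv.Perm.mul_apply, Equiv.swap_apply_right] at h
      exact hl (σ.injective h)
    · intro σ _
      rw [mul_assoc, Equiv.swap_mul_self, mul_one]
  -- Adding `g` times the vanishing sum completes each term `D g * ∏` to `D (g * ∏)`.
  rw [← Matrix.det_transpose, Matrix.det_apply, ← add_zero (∑ σ, _), ← mul_zero g, ← h0,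
    Finset.mul_sum, ← Finset.sum_add_distrib]
  refine Finset.sum_congr rfl fun σ _ => ?_
  rw [leibniz, smul_add, mul_smul_comm, add_comm]
  congr 2
  rw [smul_eq_mul, ← Finset.prod_erase_mul _ _ (Finset.mem_univ i₀)]
  congr 1
  · refine Finset.prod_congr rfl fun i hi => ?_
    simp [Matrix.updateRow_ne (Finset.ne_of_mem_erase hi)]
  · simp

/-- With `P = ∏ u_i ^ r_i`, the row of the `D_j P` is `P` times the combination of the rows of `M`
with coefficients `r_k`. As row `i₀` it gives determinant `r_{i₀} P det M`, a divergence, which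
`lam` kills. -/
theorem zsmul_map_prod_zpow_mul_det_logDeriv {B : Type*} [AddCommGroup B]
    (D : ι → Derivation S A A) (hD : ∀ j k a, D j (D k a) = D k (D j a)) (lam : A →+ B)
    (hlam : ∀ j a, lam (D j a) = 0) (u : ι → Aˣ) (r : ι → ℤ) (i₀ : ι) :
    r i₀ • lam (↑(∏ i, u i ^ r i) *
      (Matrix.of fun i j => ((D j).logDeriv (u i)).toAdd).det) = 0 := by
  set M : Matrix ι ι A := Matrix.of fun i j => ((D j).logDeriv (u i)).toAdd with hM
  set P : Aˣ := ∏ i, u i ^ r i with hP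
  have hrow : (fun j => D j (P : A)) = (P : A) • ∑ k, (r k : A) • M k := by
    ext j
    rw [apply_unit, hP, logDeriv_prod_zpow]
    simp [Finset.sum_apply, hM]
  have h := det_updateRow_eq_sum D M
    (fun i j k => apply_logDeriv_comm (hD j k) (u i)) i₀ (P : A)
  rw [hrow, Matrix.det_updateRow_smul, Matrix.det_updateRow_sum] at h
  have h2 := congrArg lam h
  rw [map_sum, Finset.sum_eq_zero fun σ _ => by
    rw [Units.smul_def, map_zsmul, hlam, smul_zero]] at h2
  rw [← map_zsmul, ← h2, zsmul_eq_mul, smul_eq_mul]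
  congr 1
  ring

/-- Factor `u_i⁻¹` out of the rows and `x_j` out of the columns. For `D_j = x_j ∂/∂x_j`, the matrix
`Q` is the Jacobian matrix. -/
theorem det_logDeriv (D : ι → Derivation S A A) {u : ι → Aˣ} {x : ι → A} {Q : Matrix ι ι A}
    (hQ : ∀ i j, D j (u i) = x j * Q i j) :
    (Matrix.of fun i j => ((D j).logDeriv (u i)).toAdd).det =
      ↑(∏ i, (u i)⁻¹) * ((∏ j, x j) * Q.det) := by
  rw [Units.coe_prod, ← Matrix.det_mul_row, ← Matrix.det_mul_column]
  congr 1
  ext1 i j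
  simp [logDeriv, hQ]

end Derivation

/-! ### Euler derivations and degree filtration on Malcev-Neumann series -/

namespace HahnSeries

section Generic

variable {Γ R : Type*} [LinearOrder Γ] [CommRing R]

/-- The series `x` with the coefficient of `t ^ g` multiplied by `χ g`. -/
def eulerScale (χ : Γ → ℤ) (x : HahnSeries Γ R) : HahnSeries Γ R where
  coeff g := χ g • x.coeff g
  isPWO_support' := x.isPWO_support.mono fun g hg h =>
    hg (show χ g • x.coeff g = 0 by rw [h, smul_zero])

theorem support_eulerScale_subset (χ : Γ → ℤ) (x : HahnSeries Γ R) :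
    (eulerScale χ x).support ⊆ x.support := fun g hg h =>
  hg (show χ g • x.coeff g = 0 by rw [h, smul_zero])

variable [AddCommGroup Γ]

/-- The series whose monomials `t ^ g` all have degree `deg g ≥ N`. -/
def degreeGE (R : Type*) [CommRing R] (deg : Γ →+ ℤ) (N : ℤ) : AddSubgroup (HahnSeries Γ R) where
  carrier := {x | ∀ g, x.coeff g ≠ 0 → N ≤ deg g}
  zero_mem' g hg := by simp at hg
  add_mem' {x y} hx hy g hg := by
    by_cases h : x.coeff g = 0
    · exact hy g (by simpa [h] using hg)
    · exact hx g h
  neg_mem' {x} hx g hg := hx g (by simpa using hg)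

variable {deg : Γ →+ ℤ}

theorem degreeGE_anti {M N : ℤ} (h : M ≤ N) : degreeGE R deg N ≤ degreeGE R deg M :=
  fun _ hx g hg => h.trans (hx g hg)

theorem single_mem_degreeGE (g : Γ) (r : R) : single g r ∈ degreeGE R deg (deg g) := by
  intro a ha
  by_cases h : a = g
  · rw [h]
  · exact absurd (coeff_single_of_ne h) ha

theorem coeff_eq_zero_of_mem_degreeGE {N : ℤ} {x : HahnSeries Γ R} (hx : x ∈ degreeGE R deg N)
    {g : Γ} (hg : deg g < N) : x.coeff g = 0 := by
  by_contra h
  exact absurd (hx g h) hg.not_ge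

theorem one_mem_degreeGE : (1 : HahnSeries Γ R) ∈ degreeGE R deg 0 := by
  simpa using single_mem_degreeGE (deg := deg) (0 : Γ) (1 : R)

variable [IsOrderedAddMonoid Γ]

/-- Lets several products be summed over one index set; the Leibniz rule needs this because Euler
scaling can shrink supports. -/
theorem coeff_mul_of_support_subset {x y : HahnSeries Γ R} {s t : Set Γ} (hs : s.IsPWO)
    (ht : t.IsPWO) (hxs : x.support ⊆ s) (hyt : y.support ⊆ t) (a : Γ) :
    (x * y).coeff a =
      ∑ p ∈ Finset.antidiagonal hs ht a, x.coeff p.1 * y.coeff p.2 := by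
  rw [coeff_mul]
  refine Finset.sum_subset ?_ ?_
  · intro p hp
    rw [Finset.mem_antidiagonal] at hp ⊢
    exact ⟨hxs hp.1, hyt hp.2.1, hp.2.2⟩
  · intro p hp hp'
    rw [Finset.mem_antidiagonal] at hp hp'
    by_contra h
    exact hp' ⟨left_ne_zero_of_mul h, right_ne_zero_of_mul h, hp.2.2⟩

/-- The Euler derivation attached to `χ`, which multiplies the coefficient of `t ^ g` by `χ g`. -/
noncomputable def eulerDerivation (χ : Γ →+ ℤ) :
    Derivation R (HahnSeries Γ R) (HahnSeries Γ R) :=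
  Derivation.mk'
    { toFun := eulerScale χ
      map_add' := fun x y => by ext g; simp [eulerScale]
      map_smul' := fun c x => by ext g; simp [eulerScale, mul_left_comm] }
    (by
      intro x y
      ext g
      simp only [LinearMap.coe_mk, AddHom.coe_mk, smul_eq_mul, coeff_add]
      rw [mul_comm y, coeff_mul_of_support_subset x.isPWO_support y.isPWO_support
        subset_rfl (support_eulerScale_subset χ y),
        coeff_mul_of_support_subset x.isPWO_support y.isPWO_support
        (support_eulerScale_subset χ x) subset_rfl]
      simp only [eulerScale]
      rw [coeff_mul, Finset.smul_sum, ← Finset.sum_add_distrib]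
      refine Finset.sum_congr rfl fun p hp => ?_
      rw [Finset.mem_antidiagonal] at hp
      simp only [← hp.2.2, map_add, zsmul_eq_mul]
      push_cast
      ring)

@[simp]
theorem coeff_eulerDerivation (χ : Γ →+ ℤ) (x : HahnSeries Γ R) (g : Γ) :
    (eulerDerivation (R := R) χ x).coeff g = χ g • x.coeff g := rfl

theorem eulerDerivation_comm (χ ψ : Γ →+ ℤ) (x : HahnSeries Γ R) :
    eulerDerivation (R := R) χ (eulerDerivation (R := R) ψ x) =
      eulerDerivation (R := R) ψ (eulerDerivation (R := R) χ x) := by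
  ext g
  simp only [coeff_eulerDerivation]
  exact smul_comm _ _ _

theorem mul_mem_degreeGE {M N : ℤ} {x y : HahnSeries Γ R} (hx : x ∈ degreeGE R deg M)
    (hy : y ∈ degreeGE R deg N) : x * y ∈ degreeGE R deg (M + N) := by
  intro g hg
  obtain ⟨a, ha, b, hb, rfl⟩ := support_mul_subset hg
  rw [map_add]
  exact add_le_add (hx a ha) (hy b hb)

theorem eulerDerivation_mem_degreeGE (χ : Γ →+ ℤ) {N : ℤ} {x : HahnSeries Γ R}
    (hx : x ∈ degreeGE R deg N) : eulerDerivation (R := R) χ x ∈ degreeGE R deg N :=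
  fun g hg => hx g fun h => hg (by simp [h])

/-- Monotonicity of `deg` makes every exponent of degree at least `1` positive, so `h` has positive
order. -/
theorem isUnit_one_add (hdeg : Monotone deg) {h : HahnSeries Γ R} (hh : h ∈ degreeGE R deg 1) :
    IsUnit (1 + h) := by
  refine isUnit_of_orderTop_pos ?_
  rw [add_sub_cancel_left]
  by_cases h0 : h = 0
  · simp [h0]
  · rw [zero_lt_orderTop_iff h0]
    by_contra hle
    have h1 := hdeg (not_lt.mp hle)
    have h2 := hh _ (mt coeff_order_eq_zero.mp h0)
    rw [map_zero] at h1
    omega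

theorem inv_mem_degreeGE (hdeg : Monotone deg) {h : HahnSeries Γ R}
    (hh : h ∈ degreeGE R deg 1) {u : (HahnSeries Γ R)ˣ} (hu : (u : HahnSeries Γ R) = 1 + h) :
    ((u⁻¹ : (HahnSeries Γ R)ˣ) : HahnSeries Γ R) ∈ degreeGE R deg 0 := by
  set v : HahnSeries Γ R := ↑u⁻¹ with hv
  have huv : v = 1 - h * v := by
    have := u.mul_inv
    rw [hu, ← hv] at this
    linear_combination this
  by_cases hv0 : v = 0
  · rw [hv0]; exact zero_mem _
  -- If the order of `v` were negative, its leading term would come from `h * v`, as `a + b` with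
  -- `deg a ≥ 1` and `b` at least the order of `v`; but then `a ≤ 0`, so `deg a ≤ 0`.
  have hord : 0 ≤ v.order := by
    by_contra! hneg
    have h1 := mt coeff_order_eq_zero.mp hv0
    rw [congrArg (fun w => w.coeff v.order) huv, coeff_sub, coeff_one, if_neg hneg.ne, zero_sub,
      neg_eq_zero] at h1
    obtain ⟨a, ha, b, hb, hab⟩ := support_mul_subset h1
    have hb' := order_le_of_coeff_ne_zero hb
    have ha' := hh a ha
    simp only at hab
    have : a ≤ 0 := by
      have : a + b ≤ 0 + b := by rw [hab, zero_add]; exact hb'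
      exact le_of_add_le_add_right this
    have := hdeg this
    rw [map_zero] at this
    omega
  intro g hg
  have := hdeg (hord.trans (order_le_of_coeff_ne_zero hg))
  rwa [map_zero] at this

/-- The monomial `t ^ g` as a unit. -/
noncomputable def monomialUnit (R : Type*) [CommRing R] (g : Γ) : (HahnSeries Γ R)ˣ where
  val := single g 1
  inv := single (-g) 1
  val_inv := by simp
  inv_val := by simp

@[simp]
theorem val_monomialUnit (g : Γ) : (monomialUnit R g : HahnSeries Γ R) = single g 1 := rfl

theorem logDeriv_monomialUnit (χ : Γ →+ ℤ) (g : Γ) :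
    ((eulerDerivation (R := R) χ).logDeriv (monomialUnit R g)).toAdd =
      ((χ g : ℤ) : HahnSeries Γ R) := by
  have h : eulerDerivation (R := R) χ (single g 1) = χ g • single g (1 : R) := by
    ext a
    rw [coeff_eulerDerivation, coeff_smul, coeff_single]
    split_ifs with ha
    · rw [ha]
    · simp
  simp only [Derivation.logDeriv, MonoidHom.coe_mk, OneHom.coe_mk, toAdd_ofAdd]
  rw [val_monomialUnit, h, zsmul_eq_mul, mul_left_comm, ← val_monomialUnit, Units.inv_mul, mul_one]

theorem logDeriv_mem_degreeGE (hdeg : Monotone deg) (χ : Γ →+ ℤ) {h : HahnSeries Γ R}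
    (hh : h ∈ degreeGE R deg 1) {u : (HahnSeries Γ R)ˣ} (hu : (u : HahnSeries Γ R) = 1 + h) :
    ((eulerDerivation (R := R) χ).logDeriv u).toAdd ∈ degreeGE R deg 1 := by
  simp only [Derivation.logDeriv, MonoidHom.coe_mk, OneHom.coe_mk, toAdd_ofAdd]
  rw [hu, map_add, Derivation.map_one_eq_zero, zero_add]
  simpa using mul_mem_degreeGE (inv_mem_degreeGE hdeg hh hu) (eulerDerivation_mem_degreeGE χ hh)

variable {ι : Type*} [Fintype ι] [DecidableEq ι]

/-- Series of degree at least `0` form a ring in which those of degree at least `1` form an ideal;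
modulo that ideal the matrix is the identity. -/
theorem det_one_add_sub_one_mem_degreeGE {N : Matrix ι ι (HahnSeries Γ R)}
    (hN : ∀ i j, N i j ∈ degreeGE R deg 1) : (1 + N).det - 1 ∈ degreeGE R deg 1 := by
  let S : Subring (HahnSeries Γ R) :=
    { degreeGE R deg 0 with
      one_mem' := one_mem_degreeGE
      mul_mem' := fun hx hy => by simpa using mul_mem_degreeGE hx hy }
  let I : Ideal S :=
    { carrier := {x | (x : HahnSeries Γ R) ∈ degreeGE R deg 1}
      zero_mem' := zero_mem (degreeGE R deg 1)
      add_mem' := fun hx hy => (degreeGE R deg 1).add_mem hx hy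
      smul_mem' := fun c x hx => by simpa using mul_mem_degreeGE c.2 hx }
  let N' : Matrix ι ι S := Matrix.of fun i j => ⟨N i j, degreeGE_anti zero_le_one (hN i j)⟩
  have h1 : Ideal.Quotient.mk I (1 + N').det = 1 := by
    rw [RingHom.map_det, map_add, map_one]
    have : (Ideal.Quotient.mk I).mapMatrix N' = 0 := by
      ext i j
      exact Ideal.Quotient.eq_zero_iff_mem.mpr (hN i j)
    rw [this, add_zero, Matrix.det_one]
  have h2 : (1 + N').det - 1 ∈ I := by
    rw [← Ideal.Quotient.eq_zero_iff_mem, map_sub, h1, map_one, sub_self]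
  have h3 : ((((1 + N').det - 1 : S)) : HahnSeries Γ R) = (1 + N).det - 1 := by
    have := RingHom.map_det S.subtype (1 + N')
    rw [map_add, map_one] at this
    exact congrArg (· - 1) this
  rw [← h3]
  exact h2

variable {χ : ι → Γ →+ ℤ} {g : ι → Γ}

/-- Characteristic zero and the absence of zero divisors serve to cancel a nonzero `r i₀` from the
divergence identity. -/
theorem coeff_zero_prod_zpow_mul_det_logDeriv_of_charZero [IsDomain R] [CharZero R]
    (hdeg : Monotone deg) (hχ : ∀ i j, χ j (g i) = if i = j then 1 else 0)
    {h : ι → HahnSeries Γ R} (hh : ∀ i, h i ∈ degreeGE R deg 1)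
    {U : ι → (HahnSeries Γ R)ˣ} (hU : ∀ i, (U i : HahnSeries Γ R) = 1 + h i) (r : ι → ℤ) :
    ((↑(∏ i, (monomialUnit R (g i) * U i) ^ r i) * (Matrix.of fun i j =>
      ((eulerDerivation (R := R) (χ j)).logDeriv (monomialUnit R (g i) * U i)).toAdd).det :
        HahnSeries Γ R).coeff 0) = if r = 0 then 1 else 0 := by
  split_ifs with hr
  · subst hr
    have hM : (Matrix.of fun i j => ((eulerDerivation (R := R) (χ j)).logDeriv
        (monomialUnit R (g i) * U i)).toAdd) = 1 + Matrix.of fun i j =>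
          ((eulerDerivation (R := R) (χ j)).logDeriv (U i)).toAdd := by
      ext1 i j
      simp only [map_mul, toAdd_mul, logDeriv_monomialUnit, hχ, Matrix.add_apply, Matrix.of_apply,
        Matrix.one_apply]
      split_ifs <;> simp
    have h1 := det_one_add_sub_one_mem_degreeGE (deg := deg) (N := Matrix.of fun i j =>
      ((eulerDerivation (R := R) (χ j)).logDeriv (U i)).toAdd)
      fun i j => logDeriv_mem_degreeGE hdeg (χ j) (hh i) (hU i)
    have h2 := coeff_eq_zero_of_mem_degreeGE h1 (g := 0) (by simp)
    rw [hM]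
    rw [coeff_sub, coeff_one, if_pos rfl, sub_eq_zero] at h2
    simpa using h2
  · obtain ⟨i₀, hi₀⟩ := Function.ne_iff.mp hr
    have h1 := Derivation.zsmul_map_prod_zpow_mul_det_logDeriv
      (fun j => eulerDerivation (R := R) (χ j)) (fun j k => eulerDerivation_comm _ _)
      (coeff.addMonoidHom (0 : Γ)) (fun j a => by simp)
      (fun i => monomialUnit R (g i) * U i) r i₀
    rw [zsmul_eq_mul, mul_eq_zero, Int.cast_eq_zero] at h1
    exact h1.resolve_left hi₀

/-- The ring homomorphism of Hahn series given by a homomorphism of the coefficient rings. -/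
noncomputable def mapRingHom {S : Type*} [CommRing S] (f : S →+* R) : HahnSeries Γ S →+* HahnSeries Γ R where
  toFun x := x.map f
  map_one' := by ext a; by_cases ha : a = 0 <;> simp [ha]
  map_zero' := by ext; simp
  map_add' x y := HahnSeries.map_add (f : S →+ R)
  map_mul' x y := HahnSeries.map_mul (f : S →ₙ+* R)

@[simp]
theorem coeff_mapRingHom {S : Type*} [CommRing S] (f : S →+* R) (x : HahnSeries Γ S) (a : Γ) :
    (mapRingHom f x).coeff a = f (x.coeff a) := rfl

theorem mapRingHom_logDeriv {S : Type*} [CommRing S] (f : S →+* R) (χ : Γ →+ ℤ)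
    (u : (HahnSeries Γ S)ˣ) :
    mapRingHom f ((eulerDerivation (R := S) χ).logDeriv u).toAdd =
      ((eulerDerivation (R := R) χ).logDeriv
        (Units.map ((mapRingHom f : HahnSeries Γ S →+* HahnSeries Γ R) : HahnSeries Γ S →* HahnSeries Γ R) u)).toAdd := by
  simp only [Derivation.logDeriv, MonoidHom.coe_mk, OneHom.coe_mk, toAdd_ofAdd, map_mul,
    ← map_inv, Units.coe_map, MonoidHom.coe_coe]
  congr 1
  ext a
  simp

/-- Residues of `F^m J(F)`, in logarithmic form. -/
theorem coeff_zero_prod_zpow_mul_det_logDeriv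
    (hdeg : Monotone deg) (hχ : ∀ i j, χ j (g i) = if i = j then 1 else 0)
    {h : ι → HahnSeries Γ R} (hh : ∀ i, h i ∈ degreeGE R deg 1)
    {U : ι → (HahnSeries Γ R)ˣ} (hU : ∀ i, (U i : HahnSeries Γ R) = 1 + h i) (r : ι → ℤ) :
    ((↑(∏ i, (monomialUnit R (g i) * U i) ^ r i) * (Matrix.of fun i j =>
      ((eulerDerivation (R := R) (χ j)).logDeriv (monomialUnit R (g i) * U i)).toAdd).det :
        HahnSeries Γ R).coeff 0) = if r = 0 then 1 else 0 := by
  classical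
  -- One indeterminate over `ℤ` for each element of `R`: a domain of characteristic zero that maps
  -- onto `R`. The section `s` sends `0` to `0`, so lifting coefficients enlarges no support and
  -- keeps the degree bound.
  let W := MvPolynomial R ℤ
  let f : W →+* R := MvPolynomial.eval₂Hom (Int.castRingHom R) id
  let s : ZeroHom R W := ⟨fun a => if a = 0 then 0 else MvPolynomial.X a, if_pos rfl⟩
  have hfs (a : R) : f (s a) = a := by
    by_cases ha : a = 0
    · simp [s, ha]
    · simp only [f, s, ZeroHom.coe_mk, if_neg ha]
      exact MvPolynomial.eval₂_X _ _ _
  let h' (i : ι) : HahnSeries Γ W := (h i).map s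
  have hh' (i : ι) : h' i ∈ degreeGE W deg 1 := fun a ha => hh i a fun h0 => ha (by simp [h', h0])
  let U' (i : ι) : (HahnSeries Γ W)ˣ := (isUnit_one_add hdeg (hh' i)).unit
  let φ := mapRingHom (Γ := Γ) f
  have hφU (i : ι) : Units.map (φ : HahnSeries Γ W →* HahnSeries Γ R)
      (monomialUnit W (g i) * U' i) = monomialUnit R (g i) * U i := by
    rw [map_mul]
    congr 1
    · ext a
      by_cases ha : a = g i <;> simp [φ, ha]
    · refine Units.ext ?_
      rw [hU, Units.coe_map, IsUnit.unit_spec]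
      simp only [MonoidHom.coe_coe, map_add, map_one, add_right_inj]
      ext a
      simp [φ, h', hfs]
  have key := congrArg f (coeff_zero_prod_zpow_mul_det_logDeriv_of_charZero (R := W) hdeg hχ hh'
    (U := U') (fun i => IsUnit.unit_spec _) r)
  rw [← coeff_mapRingHom, map_mul, RingHom.map_det] at key
  have h1 : mapRingHom f (↑(∏ i, (monomialUnit W (g i) * U' i) ^ r i) : HahnSeries Γ W) =
      ↑(∏ i, (monomialUnit R (g i) * U i) ^ r i) := by
    simp only [← hφU, ← map_zpow, ← map_prod]
    rfl
  have h2 : (mapRingHom (Γ := Γ) f).mapMatrix (Matrix.of fun i j =>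
      ((eulerDerivation (R := W) (χ j)).logDeriv (monomialUnit W (g i) * U' i)).toAdd) =
      Matrix.of fun i j => ((eulerDerivation (R := R) (χ j)).logDeriv
        (monomialUnit R (g i) * U i)).toAdd := by
    ext1 i j
    rw [RingHom.mapMatrix_apply, Matrix.map_apply, Matrix.of_apply, mapRingHom_logDeriv,
      Matrix.of_apply, ← hφU]
  rw [h1, h2] at key
  rw [key]
  split_ifs <;> simp

theorem prod_single_one {κ : Type*} (s : Finset κ) (a : κ → Γ) :
    ∏ i ∈ s, single (a i) (1 : R) = single (∑ i ∈ s, a i) 1 := by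
  classical
  induction s using Finset.induction_on with
  | empty => simp
  | insert a s ha ih =>
    rw [Finset.prod_insert ha, ih, single_mul_single, Finset.sum_insert ha, one_mul]

/-- Dividing by the leading monomial `t ^ a`, of degree `1`, leaves `1 + h` with `h` of degree at
least `1`. -/
theorem exists_unit_of_sub_single_mem (hdeg : Monotone deg) {a : Γ} (ha : deg a = 1)
    {f : HahnSeries Γ R} (hf : f - single a 1 ∈ degreeGE R deg 2) :
    ∃ h ∈ degreeGE R deg 1, ∃ U : (HahnSeries Γ R)ˣ, (U : HahnSeries Γ R) = 1 + h ∧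
      ((monomialUnit R a * U : (HahnSeries Γ R)ˣ) : HahnSeries Γ R) = f := by
  have h1 := mul_mem_degreeGE (single_mem_degreeGE (deg := deg) (-a) (1 : R)) hf
  rw [map_neg, ha] at h1
  have hU := isUnit_one_add hdeg h1
  refine ⟨_, h1, hU.unit, hU.unit_spec, ?_⟩
  rw [Units.val_mul, hU.unit_spec, val_monomialUnit, mul_add, mul_one, ← mul_assoc,
    single_mul_single, add_neg_cancel, one_mul, single_zero_one, one_mul, add_sub_cancel]

/-- The residue of `F^(a - b) J(F)` is `1` if all `aᵢ - bᵢ` are `-1`, and `0` otherwise. -/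
theorem exists_inv_coeff_prod_pow_mul_det (hdeg : Monotone deg)
    (hχ : ∀ i j, χ j (g i) = if i = j then 1 else 0) (hg : ∀ i, deg (g i) = 1)
    {f : ι → HahnSeries Γ R} (hf : ∀ i, f i - single (g i) 1 ∈ degreeGE R deg 2)
    {Q : Matrix ι ι (HahnSeries Γ R)}
    (hQ : ∀ i j, eulerDerivation (R := R) (χ j) (f i) = single (g j) 1 * Q i j) :
    ∃ v : ι → HahnSeries Γ R, (∀ i, f i * v i = 1) ∧ (∀ i, v i ∈ degreeGE R deg (-1)) ∧
      ∀ a b : ι → ℕ, ((∏ i, (f i ^ a i * v i ^ b i)) * Q.det).coeff (-∑ i, g i) =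
        if ∀ i, a i + 1 = b i then 1 else 0 := by
  choose h hh U hU hfU using fun i => exists_unit_of_sub_single_mem hdeg (hg i) (hf i)
  let u (i : ι) : (HahnSeries Γ R)ˣ := monomialUnit R (g i) * U i
  have hfu (i : ι) : (u i : HahnSeries Γ R) = f i := hfU i
  refine ⟨fun i => ↑(u i)⁻¹, fun i => by rw [← hfu, Units.mul_inv], fun i => ?_, fun a b => ?_⟩
  · have h1 := mul_mem_degreeGE (single_mem_degreeGE (deg := deg) (-g i) (1 : R))
      (inv_mem_degreeGE hdeg (hh i) (hU i))
    rw [map_neg, hg, add_zero] at h1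
    simpa [u, mul_comm, monomialUnit] using h1
  -- The `+ 1` offsets the factor `∏ (u i)⁻¹` that comes out of the logarithmic determinant; the
  -- factor `∏ t ^ g j` moves the constant term to exponent `-∑ g i`.
  · have key := coeff_zero_prod_zpow_mul_det_logDeriv hdeg hχ hh hU
      fun i => (a i : ℤ) - b i + 1
    rw [Derivation.det_logDeriv _ (u := u) fun i j => by rw [hfu]; exact hQ i j, prod_single_one,
      ← mul_assoc, ← Units.val_mul, ← Finset.prod_mul_distrib, mul_left_comm,
      coeff_single_mul, one_mul, zero_sub] at key
    have h2 : ((∏ i, (u i ^ ((a i : ℤ) - b i + 1) * (u i)⁻¹) : (HahnSeries Γ R)ˣ) :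
        HahnSeries Γ R) = ∏ i, (f i ^ a i * ((u i)⁻¹ : (HahnSeries Γ R)ˣ) ^ b i) := by
      rw [Units.coe_prod]
      refine Finset.prod_congr rfl fun i _ => ?_
      rw [zpow_add_one, mul_inv_cancel_right, zpow_sub, Units.val_mul, zpow_natCast, zpow_natCast,
        Units.val_pow_eq_pow_val, hfu, ← inv_pow, Units.val_pow_eq_pow_val]
    rw [h2] at key
    rw [key]
    refine if_congr ?_ rfl rfl
    rw [funext_iff]
    refine forall_congr' fun i => ?_
    rw [Pi.zero_apply]
    omega

end Generic

end HahnSeries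

/-! ### Power series inside Malcev-Neumann series -/

section Embedding

variable {K Γ : Type*} [Field K] {n : ℕ}

theorem coeff_powerSeriesToHahn [PartialOrder Γ] {e : (Fin n →₀ ℕ) → Γ} (he : Monotone e)
    (hinj : Function.Injective e) (φ : MvPowerSeries (Fin n) K) (d : Fin n →₀ ℕ) :
    (powerSeriesToHahn e he φ).coeff (e d) = MvPowerSeries.coeff d φ :=
  hinj.extend_apply _ _ _

theorem coeff_powerSeriesToHahn_of_notMem [PartialOrder Γ] {e : (Fin n →₀ ℕ) → Γ}
    (he : Monotone e) (φ : MvPowerSeries (Fin n) K) {g : Γ} (hg : g ∉ Set.range e) :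
    (powerSeriesToHahn e he φ).coeff g = 0 :=
  Function.extend_apply' _ _ _ hg

theorem powerSeriesToHahn_monomial [PartialOrder Γ] {e : (Fin n →₀ ℕ) → Γ} (he : Monotone e)
    (hinj : Function.Injective e) (d : Fin n →₀ ℕ) (a : K) :
    powerSeriesToHahn e he (MvPowerSeries.monomial d a) = HahnSeries.single (e d) a := by
  classical
  ext g
  by_cases hg : g ∈ Set.range e
  · obtain ⟨c, rfl⟩ := hg
    rw [coeff_powerSeriesToHahn he hinj, MvPowerSeries.coeff_monomial, HahnSeries.coeff_single]
    simp [hinj.eq_iff]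
  · rw [coeff_powerSeriesToHahn_of_notMem he _ hg, HahnSeries.coeff_single_of_ne]
    rintro rfl
    exact hg ⟨d, rfl⟩

theorem isPWO_range_of_monotone [PartialOrder Γ] {e : (Fin n →₀ ℕ) → Γ} (he : Monotone e) :
    (Set.range e).IsPWO := by
  rw [← Set.image_univ]
  exact (Set.isPWO_of_wellQuasiOrderedLE Set.univ).image_of_monotone he

theorem support_powerSeriesToHahn_subset [PartialOrder Γ] {e : (Fin n →₀ ℕ) → Γ} (he : Monotone e)
    (φ : MvPowerSeries (Fin n) K) : (powerSeriesToHahn e he φ).support ⊆ Set.range e := by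
  intro g hg
  by_contra h
  exact hg (coeff_powerSeriesToHahn_of_notMem he φ h)

variable [AddCommGroup Γ] [LinearOrder Γ] [IsOrderedAddMonoid Γ]

/-- The inclusion of power series in Malcev-Neumann series, as a ring homomorphism. -/
noncomputable def powerSeriesHom (K : Type*) [Field K] (e : (Fin n →₀ ℕ) →+ Γ) (he : Monotone e)
    (hinj : Function.Injective e) : MvPowerSeries (Fin n) K →+* HahnSeries Γ K where
  toFun := powerSeriesToHahn e he
  map_one' := by
    have := powerSeriesToHahn_monomial (K := K) he hinj 0 1
    rw [map_zero] at this
    exact this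
  map_zero' := by
    ext g
    by_cases hg : g ∈ Set.range e
    · obtain ⟨c, rfl⟩ := hg
      rw [coeff_powerSeriesToHahn he hinj]
      simp
    · rw [coeff_powerSeriesToHahn_of_notMem he _ hg, HahnSeries.coeff_zero]
  map_add' x y := by
    ext g
    by_cases hg : g ∈ Set.range e
    · obtain ⟨c, rfl⟩ := hg
      simp only [HahnSeries.coeff_add, coeff_powerSeriesToHahn he hinj, map_add]
    · simp [coeff_powerSeriesToHahn_of_notMem he _ hg]
  map_mul' x y := by
    ext g
    by_cases hg : g ∈ Set.range e
    · obtain ⟨c, rfl⟩ := hg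
      have hr := isPWO_range_of_monotone (e := e) he
      rw [HahnSeries.coeff_mul_of_support_subset hr hr (support_powerSeriesToHahn_subset he x)
        (support_powerSeriesToHahn_subset he y), coeff_powerSeriesToHahn he hinj,
        MvPowerSeries.coeff_mul]
      refine Finset.sum_bij (fun p _ => (e p.1, e p.2)) ?_ ?_ ?_ ?_
      · intro p hp
        rw [Finset.HasAntidiagonal.mem_antidiagonal] at hp
        rw [Finset.mem_antidiagonal]
        exact ⟨⟨_, rfl⟩, ⟨_, rfl⟩, by rw [← hp, map_add]⟩
      · intro p _ q _ h
        rw [Prod.mk.injEq] at h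
        exact Prod.ext (hinj h.1) (hinj h.2)
      · rintro ⟨_, _⟩ hp
        rw [Finset.mem_antidiagonal] at hp
        obtain ⟨⟨a, rfl⟩, ⟨b, rfl⟩, hab⟩ := hp
        refine ⟨(a, b), ?_, rfl⟩
        rw [Finset.HasAntidiagonal.mem_antidiagonal]
        exact hinj (by rw [map_add]; exact hab)
      · intro p _
        rw [coeff_powerSeriesToHahn he hinj, coeff_powerSeriesToHahn he hinj]
    · rw [coeff_powerSeriesToHahn_of_notMem he _ hg]
      by_contra h
      obtain ⟨a, ha, b, hb, rfl⟩ := HahnSeries.support_mul_subset (Ne.symm h)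
      obtain ⟨a, rfl⟩ := support_powerSeriesToHahn_subset he x ha
      obtain ⟨b, rfl⟩ := support_powerSeriesToHahn_subset he y hb
      exact hg ⟨a + b, map_add e a b⟩

variable {e : (Fin n →₀ ℕ) →+ Γ} (he : Monotone e) (hinj : Function.Injective e)

@[simp]
theorem coeff_powerSeriesHom (φ : MvPowerSeries (Fin n) K) (d : Fin n →₀ ℕ) :
    (powerSeriesHom K e he hinj φ).coeff (e d) = MvPowerSeries.coeff d φ :=
  coeff_powerSeriesToHahn he hinj φ d

theorem powerSeriesHom_monomial (d : Fin n →₀ ℕ) (a : K) :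
    powerSeriesHom K e he hinj (MvPowerSeries.monomial d a) = HahnSeries.single (e d) a :=
  powerSeriesToHahn_monomial he hinj d a

theorem powerSeriesHom_X (i : Fin n) : powerSeriesHom K e he hinj (MvPowerSeries.X i) =
    HahnSeries.single (e (Finsupp.single i 1)) 1 :=
  powerSeriesHom_monomial he hinj _ _

theorem powerSeriesHom_C (a : K) :
    powerSeriesHom K e he hinj (MvPowerSeries.C a) = HahnSeries.C a := by
  rw [← MvPowerSeries.monomial_zero_eq_C_apply, powerSeriesHom_monomial, map_zero]
  rfl

theorem coeff_X_mul_pderiv (j : Fin n) (φ : MvPowerSeries (Fin n) K) (d : Fin n →₀ ℕ) :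
    MvPowerSeries.coeff d (MvPowerSeries.X j * MvPowerSeries.pderiv K j φ) =
      d j * MvPowerSeries.coeff d φ := by
  classical
  rw [MvPowerSeries.X, MvPowerSeries.coeff_monomial_mul]
  split_ifs with h
  · rw [MvPowerSeries.coeff_pderiv, tsub_add_cancel_of_le h, one_mul, mul_comm]
    congr 1
    have h1 : 1 ≤ d j := by simpa using h j
    rw [Finsupp.tsub_apply, Finsupp.single_eq_same, ← Nat.cast_add_one, Nat.sub_add_cancel h1]
  · have : d j = 0 := by
      by_contra h0
      exact h (Finsupp.single_le_iff.mpr (Nat.one_le_iff_ne_zero.mpr h0))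
    simp [this]

theorem eulerDerivation_powerSeriesHom (χ : Γ →+ ℤ) (j : Fin n) (hχ : ∀ d, χ (e d) = d j)
    (φ : MvPowerSeries (Fin n) K) :
    HahnSeries.eulerDerivation (R := K) χ (powerSeriesHom K e he hinj φ) =
      HahnSeries.single (e (Finsupp.single j 1)) 1 *
        powerSeriesHom K e he hinj (MvPowerSeries.pderiv K j φ) := by
  rw [← powerSeriesHom_X he hinj, ← map_mul]
  ext g
  rw [HahnSeries.coeff_eulerDerivation]
  by_cases hg : g ∈ Set.range e
  · obtain ⟨d, rfl⟩ := hg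
    rw [coeff_powerSeriesHom, coeff_powerSeriesHom, coeff_X_mul_pderiv, hχ]
    simp
  · have h (ψ : MvPowerSeries (Fin n) K) : (powerSeriesHom K e he hinj ψ).coeff g = 0 :=
      coeff_powerSeriesToHahn_of_notMem he ψ hg
    rw [h, h, smul_zero]

theorem powerSeriesHom_mem_degreeGE {deg : Γ →+ ℤ} (hdeg : ∀ d, deg (e d) = d.degree)
    {φ : MvPowerSeries (Fin n) K} {N : ℕ} (hφ : ∀ d, MvPowerSeries.coeff d φ ≠ 0 → N ≤ d.degree) :
    powerSeriesHom K e he hinj φ ∈ HahnSeries.degreeGE K deg N := by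
  intro g hg
  obtain ⟨d, rfl⟩ := support_powerSeriesToHahn_subset he φ hg
  rw [coeff_powerSeriesHom] at hg
  rw [hdeg]
  exact_mod_cast hφ d hg

/-- When every `F i` is `X i` times a power series with nonzero constant term, the coefficients
of `F ^ (-1 - k) Φ` that give residues do not depend on the order of the exponents. -/
theorem coeff_prod_zpow_mul_powerSeriesHom {F H : Fin n → MvPowerSeries (Fin n) K}
    (hFH : ∀ i, F i = MvPowerSeries.X i * H i)
    (hH : ∀ i, MvPowerSeries.constantCoeff (H i) ≠ 0) (k : Fin n →₀ ℕ)
    (Φ : MvPowerSeries (Fin n) K) :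
    ((∏ i, powerSeriesHom K e he hinj (F i) ^ (-1 - (k i : ℤ))) *
      powerSeriesHom K e he hinj Φ).coeff (e k - ∑ i, (k i + 1) • e (Finsupp.single i 1)) =
      MvPowerSeries.coeff k ((∏ i, (H i)⁻¹ ^ (k i + 1)) * Φ) := by
  set E := powerSeriesHom K e he hinj
  -- `H i` is inverted among power series, so the order on exponents plays no role; what remains is
  -- a shift by a monomial.
  have h1 (i : Fin n) : E (F i) ^ (-1 - (k i : ℤ)) =
      HahnSeries.single (-((k i + 1) • e (Finsupp.single i 1))) 1 * E ((H i)⁻¹ ^ (k i + 1)) := by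
    have h2 : -1 - (k i : ℤ) = -((k i + 1 : ℕ) : ℤ) := by push_cast; ring
    rw [h2, zpow_neg, zpow_natCast, hFH, map_mul, mul_pow, mul_inv, powerSeriesHom_X,
      HahnSeries.single_pow, HahnSeries.inv_single, one_pow, inv_one, map_pow, ← inv_pow]
    congr 2
    refine inv_eq_of_mul_eq_one_right ?_
    rw [← map_mul, MvPowerSeries.mul_inv_cancel _ (hH i), map_one]
  rw [Finset.prod_congr rfl fun i _ => h1 i, Finset.prod_mul_distrib, HahnSeries.prod_single_one,
    mul_assoc, ← map_prod, ← map_mul, HahnSeries.coeff_single_mul, Finset.sum_neg_distrib,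
    sub_neg_eq_add, sub_add_cancel, one_mul, coeff_powerSeriesHom]

end Embedding

/-! ### The product of geometric series -/

/-- The power series with given coefficients. -/
def MvPowerSeries.ofCoeff {σ R : Type*} (f : (σ →₀ ℕ) → R) : MvPowerSeries σ R := f

@[simp]
theorem MvPowerSeries.coeff_ofCoeff {σ R : Type*} [Semiring R] (f : (σ →₀ ℕ) → R) (d : σ →₀ ℕ) :
    coeff d (ofCoeff f) = f d := rfl

/-- The expansion of `∏ 1 / (aᵢ - Xᵢ)` as a product of geometric series. -/
theorem MvPowerSeries.prod_C_sub_X_mul_eq_one {L : Type*} [Field L] {n : ℕ} {a : Fin n → L}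
    (ha : ∀ i, a i ≠ 0) :
    (∏ i, (C (a i) - X i)) *
      ofCoeff (fun k => ∏ i, a i ^ (-1 - (k i : ℤ))) = 1 := by
  classical
  -- Multiplying by the factor for `j` collapses the geometric series in `X j` to its term `k j =
  -- 0`; induction runs over the factors already used.
  suffices h : ∀ s : Finset (Fin n), (∏ i ∈ s, (C (a i) - X i)) *
      ofCoeff (fun k => ∏ i, a i ^ (-1 - (k i : ℤ))) =
      ofCoeff (fun k => if ∀ i ∈ s, k i = 0 then ∏ i ∈ sᶜ, a i ^ (-1 - (k i : ℤ)) else 0) by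
    rw [h]
    ext k
    rw [coeff_one, coeff_ofCoeff]
    refine (if_congr ?_ (by simp) rfl)
    simp [Finsupp.ext_iff]
  intro s
  induction s using Finset.induction_on with
  | empty => simp
  | insert j s hj ih =>
    rw [Finset.prod_insert hj, mul_assoc, ih]
    ext k
    rw [sub_mul, map_sub, coeff_C_mul, X, coeff_monomial_mul, one_mul]
    simp only [coeff_ofCoeff, Finsupp.single_le_iff]
    have hsj : sᶜ = insert j (insert j s)ᶜ := by
      ext i
      by_cases h : i = j <;> simp [h, hj]
    have hjn : j ∉ (insert j s)ᶜ := by simp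
    have hne (i : Fin n) (hi : i ≠ j) : (k - Finsupp.single j 1 : Fin n →₀ ℕ) i = k i := by
      simp [hi]
    have hall : (∀ i ∈ s, (k - Finsupp.single j 1 : Fin n →₀ ℕ) i = 0) ↔ ∀ i ∈ s, k i = 0 :=
      forall₂_congr fun i hi => by rw [hne i (by rintro rfl; exact hj hi)]
    by_cases hs : ∀ i ∈ s, k i = 0
    · rw [if_pos hs, if_pos (hall.mpr hs), hsj, Finset.prod_insert hjn, Finset.prod_insert hjn]
      have hp : ∏ i ∈ (insert j s)ᶜ, a i ^ (-1 - (((k - Finsupp.single j 1 : Fin n →₀ ℕ) i : ℕ) : ℤ)) =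
          ∏ i ∈ (insert j s)ᶜ, a i ^ (-1 - (k i : ℤ)) :=
        Finset.prod_congr rfl fun i hi => by rw [hne i (by rintro rfl; exact hjn hi)]
      -- Telescoping: `a j` times the coefficient at `k j` equals the coefficient at `k j - 1`, so
      -- only `k j = 0` survives.
      rw [hp, ← mul_assoc, ← zpow_one_add₀ (ha j)]
      by_cases hk : k j = 0
      · have : ∀ i ∈ insert j s, k i = 0 := by simpa [hk] using hs
        rw [if_pos this, if_neg (by simp [hk])]
        simp [hk]
      · have : ¬∀ i ∈ insert j s, k i = 0 := fun h => hk (h j (Finset.mem_insert_self _ _))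
        rw [if_neg this, if_pos (Nat.one_le_iff_ne_zero.mpr hk), sub_eq_zero]
        congr 2
        rw [Finsupp.tsub_apply, Finsupp.single_eq_same]
        omega
    · have : ¬∀ i ∈ insert j s, k i = 0 := fun h => hs fun i hi =>
        h i (Finset.mem_insert_of_mem hi)
      rw [if_neg hs, if_neg (mt hall.mp hs), if_neg this]
      simp

/-! ### Exponents, coordinates and total degree -/

namespace RevLexExp

/-- `RevLexExp.ofNat` as an additive homomorphism. -/
def ofNatHom (n : ℕ) : (Fin n →₀ ℕ) →+ RevLexExp n where
  toFun := ofNat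
  map_zero' := rfl
  map_add' a b := by ext i; simp [ofNat]

theorem ofNat_injective (n : ℕ) : Function.Injective (ofNat (n := n)) := fun a b h => by
  ext i
  exact Int.ofNat_inj.mp (congrFun (congrArg exp h) i)

end RevLexExp

namespace RhoExp

/-- `RhoExp.ofNat` as an additive homomorphism. -/
def ofNatHom (n : ℕ) : (Fin n →₀ ℕ) →+ RhoExp n where
  toFun := ofNat
  map_zero' := rfl
  map_add' a b := by ext i; simp [ofNat]

theorem ofNat_injective (n : ℕ) : Function.Injective (ofNat (n := n)) := fun a b h => by
  ext i
  exact Int.ofNat_inj.mp (congrFun (congrArg exp h) i)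

/-- The exponent of one variable. -/
def coord {n : ℕ} (j : Fin n) : RhoExp n →+ ℤ where
  toFun k := k.exp j
  map_zero' := rfl
  map_add' _ _ := rfl

/-- The total degree. -/
def totalDegree (n : ℕ) : RhoExp n →+ ℤ where
  toFun k := ∑ i, k.exp i
  map_zero' := Finset.sum_eq_zero fun _ _ => rfl
  map_add' a b := by simp [Finset.sum_add_distrib]

@[simp]
theorem exp_ofNatHom {n : ℕ} (d : Fin n →₀ ℕ) (i : Fin n) : (ofNatHom n d).exp i = d i := rfl

@[simp]
theorem coord_apply {n : ℕ} (j : Fin n) (k : RhoExp n) : coord j k = k.exp j := rfl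

@[simp]
theorem totalDegree_apply {n : ℕ} (k : RhoExp n) : totalDegree n k = ∑ i, k.exp i := rfl

/-- The total degree is the last coordinate of `rho`, hence the first one compared. This is the
purpose of `ρ`. -/
theorem totalDegree_monotone (n : ℕ) : Monotone (totalDegree n) := by
  intro a b h
  have hlast (c : RhoExp n) : (rho c).exp (Fin.last n) = totalDegree n c := by
    simp [rho, totalDegree]
  rw [← hlast, ← hlast]
  rcases h with h | ⟨i, hi, hlt⟩
  · exact (congrFun (toColex.injective h) _).le
  · rcases (Fin.le_last i).lt_or_eq with h | rfl
    · exact (hi _ h).le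
    · exact hlt.le

end RhoExp

/-! ### Residues in the field ordered by `ρ` -/

section Rho

variable {K : Type*} [Field K] {n : ℕ}

/-- `toRho` as a ring homomorphism. -/
noncomputable def toRhoHom (K : Type*) [Field K] (n : ℕ) :
    MvPowerSeries (Fin n) K →+* HahnSeries (RhoExp n) K :=
  powerSeriesHom K (RhoExp.ofNatHom n) (RhoExp.ofNat_monotone n) (RhoExp.ofNat_injective n)

theorem toRhoHom_apply (φ : MvPowerSeries (Fin n) K) : toRhoHom K n φ = toRho φ := rfl

/-- `toRevLex` as a ring homomorphism. -/
noncomputable def toRevLexHom (K : Type*) [Field K] (n : ℕ) :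
    MvPowerSeries (Fin n) K →+* HahnSeries (RevLexExp n) K :=
  powerSeriesHom K (RevLexExp.ofNatHom n) (RevLexExp.ofNat_monotone n)
    (RevLexExp.ofNat_injective n)

/-- The Malcev-Neumann series of total degree at least `N`. -/
noncomputable abbrev rhoDegreeGE (K : Type*) [Field K] (n : ℕ) (N : ℤ) :
    AddSubgroup (HahnSeries (RhoExp n) K) :=
  HahnSeries.degreeGE K (RhoExp.totalDegree n) N

theorem toRho_mem_rhoDegreeGE {φ : MvPowerSeries (Fin n) K} {N : ℕ}
    (hφ : ∀ d, MvPowerSeries.coeff d φ ≠ 0 → N ≤ d.degree) : toRho φ ∈ rhoDegreeGE K n N :=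
  powerSeriesHom_mem_degreeGE (e := RhoExp.ofNatHom n) (RhoExp.ofNat_monotone n)
    (RhoExp.ofNat_injective n) (fun d => by simp [Finsupp.degree_eq_sum]) hφ

theorem totalDegree_varExp (i : Fin n) :
    RhoExp.totalDegree n (RhoExp.ofNatHom n (Finsupp.single i 1)) = 1 := by
  classical
  simp [Finsupp.single_apply]

theorem coord_varExp (i j : Fin n) :
    RhoExp.coord j (RhoExp.ofNatHom n (Finsupp.single i 1)) = if i = j then 1 else 0 := by
  classical
  simp [Finsupp.single_apply]

theorem sum_varExp (n : ℕ) :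
    ∑ i, RhoExp.ofNatHom n (Finsupp.single i 1) = ⟨fun _ => 1⟩ := by
  classical
  rw [← map_sum]
  ext j
  rw [RhoExp.exp_ofNatHom]
  simp [Finsupp.finsetSum_apply, Finsupp.single_apply]

variable {F : Fin n → MvPowerSeries (Fin n) K}
  (hF : ∀ (i : Fin n) (d : Fin n →₀ ℕ), d.degree ≤ 1 →
      MvPowerSeries.coeff d (F i) = MvPowerSeries.coeff d (MvPowerSeries.X i))

include hF

/-- The residue of `F^(a - b) J(F)`, and a bound for the degrees in `1 / Fᵢ`. -/
theorem toRho_inv_mem_and_resRho :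
    (∀ i, toRho (F i) ≠ 0) ∧ (∀ i, (toRho (F i))⁻¹ ∈ rhoDegreeGE K n (-1)) ∧
    ∀ a b : Fin n → ℕ, resRho ((∏ i, (toRho (F i) ^ a i * (toRho (F i))⁻¹ ^ b i)) *
      toRho (jacobianDet F)) = if ∀ i, a i + 1 = b i then 1 else 0 := by
  have h2 (i : Fin n) : toRho (F i) - HahnSeries.single
      (RhoExp.ofNatHom n (Finsupp.single i 1)) 1 ∈ rhoDegreeGE K n (2 : ℕ) := by
    have h1 : toRho (F i) - HahnSeries.single (RhoExp.ofNatHom n (Finsupp.single i 1)) 1 =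
        toRho (F i - MvPowerSeries.X i) := by
      rw [← powerSeriesHom_X (RhoExp.ofNat_monotone n) (RhoExp.ofNat_injective n)]
      exact (map_sub (toRhoHom K n) _ _).symm
    rw [h1]
    refine toRho_mem_rhoDegreeGE fun d hd => ?_
    by_contra hlt
    exact hd (by rw [map_sub, hF i d (by omega), sub_self])
  obtain ⟨v, hv, hv', hres⟩ := HahnSeries.exists_inv_coeff_prod_pow_mul_det
    (χ := fun j => RhoExp.coord j) (RhoExp.totalDegree_monotone n) coord_varExp
    totalDegree_varExp h2 (Q := (toRhoHom K n).mapMatrix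
      (Matrix.of fun i j => MvPowerSeries.pderiv K j (F i)))
    (fun i j => eulerDerivation_powerSeriesHom (e := RhoExp.ofNatHom n) (RhoExp.ofNat_monotone n)
      (RhoExp.ofNat_injective n) (RhoExp.coord j) j (fun d => rfl) (F i))
  have hinv (i : Fin n) : (toRho (F i))⁻¹ = v i := inv_eq_of_mul_eq_one_right (hv i)
  refine ⟨fun i => left_ne_zero_of_mul_eq_one (hv i), fun i => by rw [hinv]; exact hv' i,
    fun a b => ?_⟩
  simp only [hinv]
  refine Eq.trans ?_ ((hres a b).trans (by congr))
  rw [← RingHom.map_det, sum_varExp]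
  rfl

theorem toRho_ne_zero (i : Fin n) : toRho (F i) ≠ 0 := (toRho_inv_mem_and_resRho hF).1 i

theorem toRho_inv_mem (i : Fin n) : (toRho (F i))⁻¹ ∈ rhoDegreeGE K n (-1) :=
  (toRho_inv_mem_and_resRho hF).2.1 i

/-- The three factors have degree at least `-n - |k|`, `|k| + 1` and `0`, so the product has degree
at least `1 - n`, while the residue sits in degree `-n`. This discards the tail of a substituted
series. -/
theorem resRho_prod_zpow_mul_eq_zero (k : Fin n →₀ ℕ) {R : MvPowerSeries (Fin n) K}
    (hR : ∀ d, MvPowerSeries.coeff d R ≠ 0 → k.degree + 1 ≤ d.degree)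
    (J : MvPowerSeries (Fin n) K) :
    resRho ((∏ i, toRho (F i) ^ (-1 - (k i : ℤ))) * toRho R * toRho J) = 0 := by
  have hpow (i : Fin n) (m : ℕ) : (toRho (F i))⁻¹ ^ m ∈ rhoDegreeGE K n (-m) := by
    induction m with
    | zero => simpa using HahnSeries.one_mem_degreeGE
    | succ m ih =>
      have := HahnSeries.mul_mem_degreeGE ih (toRho_inv_mem hF i)
      rw [pow_succ]
      convert this using 2
      push_cast
      ring
  have hprod (s : Finset (Fin n)) : ∏ i ∈ s, toRho (F i) ^ (-1 - (k i : ℤ)) ∈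
      rhoDegreeGE K n (∑ i ∈ s, (-1 - (k i : ℤ))) := by
    classical
    induction s using Finset.induction_on with
    | empty => simpa using HahnSeries.one_mem_degreeGE
    | insert a s ha ih =>
      rw [Finset.prod_insert ha, Finset.sum_insert ha]
      refine HahnSeries.mul_mem_degreeGE ?_ ih
      have h1 : -1 - (k a : ℤ) = -((k a + 1 : ℕ) : ℤ) := by push_cast; ring
      rw [h1, zpow_neg, zpow_natCast, ← inv_pow]
      exact hpow a _
  have h1 := HahnSeries.mul_mem_degreeGE (HahnSeries.mul_mem_degreeGE (hprod Finset.univ)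
    (toRho_mem_rhoDegreeGE hR)) (toRho_mem_rhoDegreeGE (φ := J) (N := 0) fun d _ => Nat.zero_le _)
  refine HahnSeries.coeff_eq_zero_of_mem_degreeGE h1 ?_
  rw [Finsupp.degree_eq_sum]
  push_cast
  simp only [RhoExp.totalDegree_apply, Finset.sum_sub_distrib]
  linarith

/-- The coefficients of a series `Ψ` from the residues of `Ψ(F)`. -/
theorem resRho_prod_zpow_mul_subst (hF0 : ∀ i, MvPowerSeries.constantCoeff (F i) = 0)
    (k : Fin n →₀ ℕ) (Ψ : MvPowerSeries (Fin n) K) :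
    resRho ((∏ i, toRho (F i) ^ (-1 - (k i : ℤ))) * toRho (MvPowerSeries.subst F Ψ) *
      toRho (jacobianDet F)) = MvPowerSeries.coeff k Ψ := by
  classical
  have hs : MvPowerSeries.HasSubst F := MvPowerSeries.hasSubst_of_constantCoeff_zero hF0
  -- The residue functional `lam` is only additive, so the infinite sum `Ψ(F)` is cut: `p` keeps the
  -- terms of degree at most `|k|`, and substituting `F`, of order at least `1`, does not lower the
  -- order of the rest.
  set p := MvPowerSeries.truncTotal (k.degree + 1) Ψ with hp
  set E := ∏ i, toRho (F i) ^ (-1 - (k i : ℤ)) with hE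
  let lam : MvPowerSeries (Fin n) K →+ K :=
    { toFun := fun φ => resRho (E * toRho φ * toRho (jacobianDet F))
      map_zero' := by
        rw [← toRhoHom_apply 0, map_zero, mul_zero, zero_mul]
        rfl
      map_add' := fun a b => by
        rw [← toRhoHom_apply (a + b), map_add, mul_add, add_mul]
        exact HahnSeries.coeff_add }
  have htail : lam (MvPowerSeries.subst F (Ψ - (p : MvPowerSeries (Fin n) K))) = 0 := by
    refine resRho_prod_zpow_mul_eq_zero hF k (fun d hd => ?_) _
    have h1 : ((k.degree + 1 : ℕ) : ℕ∞) ≤ (Ψ - (p : MvPowerSeries (Fin n) K)).order := by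
      refine MvPowerSeries.nat_le_order fun c hc => ?_
      rw [map_sub, MvPolynomial.coeff_coe, hp, MvPowerSeries.coeff_truncTotal _ hc, sub_self]
    have h2 : (1 : ℕ∞) ≤ ⨅ i, (F i).order :=
      le_iInf fun i => MvPowerSeries.one_le_order_iff_constCoeff_eq_zero.mpr (hF0 i)
    have h3 := (mul_le_mul' h2 h1).trans (MvPowerSeries.le_order_subst hs _)
    rw [one_mul] at h3
    exact_mod_cast h3.trans (MvPowerSeries.order_le hd)
  have hmon (d : Fin n →₀ ℕ) (c : K) : lam (MvPowerSeries.C c * ∏ i, F i ^ d i) =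
      if d = k then c else 0 := by
    have h1 : E * toRho (MvPowerSeries.C c * ∏ i, F i ^ d i) * toRho (jacobianDet F) =
        HahnSeries.C c * ((∏ i, (toRho (F i) ^ d i * (toRho (F i))⁻¹ ^ (k i + 1))) *
          toRho (jacobianDet F)) := by
      have h2 : toRho (MvPowerSeries.C c * ∏ i, F i ^ d i) =
          HahnSeries.C c * ∏ i, toRho (F i) ^ d i := by
        rw [← toRhoHom_apply, map_mul, map_prod]
        congr 1
        · exact powerSeriesHom_C (e := RhoExp.ofNatHom n) (RhoExp.ofNat_monotone n)
            (RhoExp.ofNat_injective n) c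
        · exact Finset.prod_congr rfl fun i _ => map_pow _ _ _
      rw [h2, mul_left_comm, mul_assoc, hE, ← Finset.prod_mul_distrib]
      congr 2
      refine Finset.prod_congr rfl fun i _ => ?_
      rw [show -1 - (k i : ℤ) = -((k i + 1 : ℕ) : ℤ) by push_cast; ring, zpow_neg, zpow_natCast,
        inv_pow, mul_comm]
    have h3 := (toRho_inv_mem_and_resRho hF).2.2 d fun i => k i + 1
    change resRho (E * toRho (MvPowerSeries.C c * ∏ i, F i ^ d i) * toRho (jacobianDet F)) = _
    rw [h1, resRho, HahnSeries.C_apply, HahnSeries.coeff_single_zero_mul]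
    rw [resRho] at h3
    rw [h3, mul_ite, mul_one, mul_zero]
    refine if_congr ?_ rfl rfl
    simp [Finsupp.ext_iff]
  have hsplit : MvPowerSeries.subst F Ψ = MvPowerSeries.subst F (p : MvPowerSeries (Fin n) K) +
      MvPowerSeries.subst F (Ψ - (p : MvPowerSeries (Fin n) K)) := by
    rw [← MvPowerSeries.subst_add hs, add_sub_cancel]
  change lam (MvPowerSeries.subst F Ψ) = _
  rw [hsplit, map_add, htail, add_zero, MvPowerSeries.subst_coe, MvPolynomial.aeval_def,
    MvPolynomial.eval₂_eq', map_sum]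
  simp only [MvPowerSeries.algebraMap_apply, Algebra.algebraMap_self, RingHom.id_apply]
  rw [Finset.sum_congr rfl fun d _ => hmon d _, Finset.sum_ite_eq']
  have hk : p.coeff k = MvPowerSeries.coeff k Ψ :=
    MvPowerSeries.coeff_truncTotal _ (Nat.lt_succ_self _)
  split_ifs with h
  · exact hk
  · rw [← hk, MvPolynomial.notMem_support_iff.mp h]

end Rho

/-! ### Comparison of the two fields, generating function in `y`, and the theorem -/

section Main

variable {K : Type*} [Field K] {n : ℕ}

theorem RhoExp.ofNat_sub_sum (k : Fin n →₀ ℕ) :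
    RhoExp.ofNatHom n k - ∑ i, (k i + 1) • RhoExp.ofNatHom n (Finsupp.single i 1) =
      ⟨fun _ => -1⟩ := by
  classical
  simp only [← map_nsmul, ← map_sum]
  rw [sub_eq_iff_eq_add']
  ext j
  rw [RhoExp.exp_add, Pi.add_apply, RhoExp.exp_ofNatHom, RhoExp.exp_ofNatHom]
  simp [Finsupp.single_apply, Finset.sum_add_distrib]

theorem RevLexExp.ofNat_sub_sum (k : Fin n →₀ ℕ) :
    RevLexExp.ofNatHom n k - ∑ i, (k i + 1) • RevLexExp.ofNatHom n (Finsupp.single i 1) =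
      ⟨fun _ => -1⟩ := by
  classical
  simp only [← map_nsmul, ← map_sum]
  rw [sub_eq_iff_eq_add']
  ext j
  rw [RevLexExp.exp_add, Pi.add_apply]
  change (k j : ℤ) = ((∑ i, (k i + 1) • Finsupp.single i 1 : Fin n →₀ ℕ) j : ℤ) + -1
  simp [Finsupp.single_apply, Finset.sum_add_distrib]

/-- When every `F i` is `X i` times a power series with nonzero constant term, the residues of
`F ^ (-1 - k) Φ` in the two fields agree. -/
theorem resRevLex_eq_resRho {F H : Fin n → MvPowerSeries (Fin n) K}
    (hFH : ∀ i, F i = MvPowerSeries.X i * H i)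
    (hH : ∀ i, MvPowerSeries.constantCoeff (H i) ≠ 0) (k : Fin n →₀ ℕ)
    (Φ : MvPowerSeries (Fin n) K) :
    resRevLex ((∏ i, toRevLex (F i) ^ (-1 - (k i : ℤ))) * toRevLex Φ) =
      resRho ((∏ i, toRho (F i) ^ (-1 - (k i : ℤ))) * toRho Φ) := by
  have h1 := coeff_prod_zpow_mul_powerSeriesHom (e := RevLexExp.ofNatHom n)
    (RevLexExp.ofNat_monotone n) (RevLexExp.ofNat_injective n) hFH hH k Φ
  have h2 := coeff_prod_zpow_mul_powerSeriesHom (e := RhoExp.ofNatHom n)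
    (RhoExp.ofNat_monotone n) (RhoExp.ofNat_injective n) hFH hH k Φ
  rw [RevLexExp.ofNat_sub_sum] at h1
  rw [RhoExp.ofNat_sub_sum] at h2
  exact h1.trans h2.symm

/-- The inclusion of `L[[y]]` in `L⟪y⟫`, for `L = K^ρ⟪x⟫`. -/
noncomputable def inYHom (K : Type*) [Field K] (n : ℕ) :
    MvPowerSeries (Fin n) (HahnSeries (RhoExp n) K) →+*
      HahnSeries (RevLexExp n) (HahnSeries (RhoExp n) K) :=
  toRevLexHom (HahnSeries (RhoExp n) K) n

theorem inYHom_C (φ : MvPowerSeries (Fin n) K) :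
    inYHom K n (MvPowerSeries.C (toRho φ)) = inX φ :=
  powerSeriesHom_C (e := RevLexExp.ofNatHom n) (RevLexExp.ofNat_monotone n)
    (RevLexExp.ofNat_injective n) (toRho φ)

theorem inYHom_X (i : Fin n) : inYHom K n (MvPowerSeries.X i) = yVar K i := by
  refine (powerSeriesHom_X (e := RevLexExp.ofNatHom n) (RevLexExp.ofNat_monotone n)
    (RevLexExp.ofNat_injective n) i).trans ?_
  refine congrArg (fun g => HahnSeries.single g 1) ?_
  ext j
  change ((Finsupp.single i 1 : Fin n →₀ ℕ) j : ℤ) = (Pi.single i 1 : Fin n → ℤ) j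
  by_cases h : i = j
  · subst h; simp
  · simp [h]

theorem resX_inYHom (Ψ : MvPowerSeries (Fin n) (HahnSeries (RhoExp n) K))
    {Θ : MvPowerSeries (Fin n) K}
    (h : ∀ k, MvPowerSeries.coeff k Θ = resRho (MvPowerSeries.coeff k Ψ)) :
    toRevLex Θ = resX (inYHom K n Ψ) := by
  ext g
  change _ = resRho ((inYHom K n Ψ).coeff g)
  by_cases hg : g ∈ Set.range (RevLexExp.ofNatHom n)
  · obtain ⟨k, rfl⟩ := hg
    have h1 := coeff_powerSeriesHom (e := RevLexExp.ofNatHom n) (RevLexExp.ofNat_monotone n)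
      (RevLexExp.ofNat_injective n) Θ k
    have h2 := coeff_powerSeriesHom (e := RevLexExp.ofNatHom n) (RevLexExp.ofNat_monotone n)
      (RevLexExp.ofNat_injective n) Ψ k
    exact h1.trans ((h k).trans (congrArg resRho h2.symm))
  · have h1 := coeff_powerSeriesToHahn_of_notMem (RevLexExp.ofNat_monotone n) Θ hg
    have h2 := coeff_powerSeriesToHahn_of_notMem (RevLexExp.ofNat_monotone n) Ψ hg
    exact h1.trans (congrArg resRho h2.symm)

/-- The geometric series inverts the product already in `L[[y]]`, and inverses in the larger field
are unique. -/
theorem prod_inv_inX_sub_yVar {F : Fin n → MvPowerSeries (Fin n) K}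
    (hF : ∀ i, toRho (F i) ≠ 0) :
    ∏ i, (inX (F i) - yVar K i)⁻¹ =
      inYHom K n (MvPowerSeries.ofCoeff fun k => ∏ i, toRho (F i) ^ (-1 - (k i : ℤ))) := by
  rw [Finset.prod_inv_distrib]
  refine inv_eq_of_mul_eq_one_right ?_
  have h := congrArg (inYHom K n) (MvPowerSeries.prod_C_sub_X_mul_eq_one hF)
  rw [map_one, map_mul, map_prod] at h
  rw [← h]
  congr 1
  exact Finset.prod_congr rfl fun i _ => by rw [map_sub, inYHom_C, inYHom_X]

end Main

theorem mainTheorem6 {K : Type*} [Field K] {n : ℕ} (F G : Fin n → MvPowerSeries (Fin n) K)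
    (hF : ∀ (i : Fin n) (d : Fin n →₀ ℕ), d.degree ≤ 1 →
      MvPowerSeries.coeff d (F i) = MvPowerSeries.coeff d (MvPowerSeries.X i))
    (hG : IsCompInverse F G) (Φ : MvPowerSeries (Fin n) K) :
    (toRevLex (MvPowerSeries.subst G Φ) =
      resX ((∏ i, (inX (F i) - yVar K i)⁻¹) * inX (jacobianDet F) * inX Φ)) ∧
    (∀ k : Fin n →₀ ℕ, MvPowerSeries.coeff k (MvPowerSeries.subst G Φ) =
      resRho ((∏ i, toRho (F i) ^ (-1 - (k i : ℤ))) * toRho Φ * toRho (jacobianDet F))) ∧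
    ((∀ i, MvPowerSeries.X i ∣ F i) →
      ∀ k : Fin n →₀ ℕ, MvPowerSeries.coeff k (MvPowerSeries.subst G Φ) =
        resRevLex ((∏ i, toRevLex (F i) ^ (-1 - (k i : ℤ))) * toRevLex Φ *
          toRevLex (jacobianDet F))) := by
  obtain ⟨hF0, hG0, -, hGF⟩ := hG
  -- This presents `Φ` as `Ψ(F)` with `Ψ = Φ ∘ G`, the form in which residues read off the
  -- coefficients of `Ψ`.
  have hΦ : MvPowerSeries.subst F (MvPowerSeries.subst G Φ) = Φ := by
    rw [MvPowerSeries.subst_comp_subst_apply (MvPowerSeries.hasSubst_of_constantCoeff_zero hG0)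
      (MvPowerSeries.hasSubst_of_constantCoeff_zero hF0), funext hGF, MvPowerSeries.subst_self]
    rfl
  have h2 (k : Fin n →₀ ℕ) : MvPowerSeries.coeff k (MvPowerSeries.subst G Φ) =
      resRho ((∏ i, toRho (F i) ^ (-1 - (k i : ℤ))) * toRho Φ * toRho (jacobianDet F)) := by
    rw [← resRho_prod_zpow_mul_subst hF hF0 k, hΦ]
  refine ⟨?_, h2, fun hX k => ?_⟩
  · rw [prod_inv_inX_sub_yVar (toRho_ne_zero hF), ← inYHom_C, ← inYHom_C, ← map_mul, ← map_mul]
    refine resX_inYHom _ fun k => ?_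
    rw [h2, MvPowerSeries.coeff_mul_C, MvPowerSeries.coeff_mul_C, MvPowerSeries.coeff_ofCoeff,
      mul_right_comm]
  · choose H hH using hX
    -- The constant term of `H i` is the coefficient of `x_i` in `F i`, which is `1`.
    have hH0 (i : Fin n) : MvPowerSeries.constantCoeff (H i) ≠ 0 := by
      have h1 := hF i (Finsupp.single i 1) (by simp)
      have h3 := MvPowerSeries.coeff_add_monomial_mul (Finsupp.single i 1) 0 (H i) (1 : K)
      rw [add_zero] at h3
      rw [hH, MvPowerSeries.coeff_index_single_self_X, MvPowerSeries.X, h3, one_mul,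
        MvPowerSeries.coeff_zero_eq_constantCoeff_apply] at h1
      rw [h1]
      exact one_ne_zero
    have h4 := resRevLex_eq_resRho hH hH0 k (Φ * jacobianDet F)
    have h5 : toRevLex (Φ * jacobianDet F) = toRevLex Φ * toRevLex (jacobianDet F) :=
      map_mul (toRevLexHom K n) _ _
    have h6 : toRho (Φ * jacobianDet F) = toRho Φ * toRho (jacobianDet F) :=
      map_mul (toRhoHom K n) _ _
    rw [h2, mul_assoc, mul_assoc, ← h5, ← h6, h4]
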